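/- Let $V\subset\mathbb{C}^s$ be an affine toric variety: an irreducible affine variety containing, as a Zariski dense open subset, a torus $T$ (so $T\simeq(\mathbb{C}^*)^n$ as a variety and as a group, for some $n$), such that the action of $T$ on itself by multiplication extends to an algebraic action $T\times V\to V$. Let $M$ be the character lattice of $T$ (the group of morphisms $\chi^m:T\to\mathbb{C}^*$ that are group homomorphisms, written additively), $N=\operatorname{Hom}_{\mathbb{Z}}(M,\mathbb{Z})$ its cocharacter lattice, $N_{\mathbb{R}}=N\otimes_{\mathbb{Z}}\mathbb{R}$ and $M_{\mathbb{R}}=\operatorname{Hom}_{\mathbb{R}}(N_{\mathbb{R}},\mathbb{R})$. For a finitely generated submonoid (affine semigroup) $\mathcal{S}\subset M$, let $\mathbb{C}[\mathcal{S}]$ be its semigroup algebra, with basis $\{\chi^m : m\in \mathcal{S}\}$; $\mathcal{S}$ is saturated if $km\in\mathcal{S}$ with $k\in\mathbb{N}_{>0}$, $m\in M$ implies $m\in\mathcal{S}$. A rational cone in $N_{\mathbb{R}}$ is a cone $\sigma$ generated by a finite subset of $N$; it is strongly convex if $\sigma\cap(-\sigma)=\{0\}$, and $U_\sigma=\operatorname{Specm}(\mathbb{C}[\mathcal{S}_\sigma])$,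 where $\mathcal{S}_\sigma=\sigma^\vee\cap M$ and $\sigma^\vee\subset M_{\mathbb{R}}$ is the dual cone. The following are equivalent. 1. $V$ is normal, that is, its coordinate ring $\mathbb{C}[V]$ is integrally closed in its field of fractions. 2. $V=\operatorname{Specm}(\mathbb{C}[\mathcal{S}])$ for a saturated affine semigroup $\mathcal{S}\subset M$. 3. $V\simeq U_\sigma$ for some strongly convex rational cone $\sigma\subset N_{\mathbb{R}}$. Here $V=\operatorname{Specm}(\mathbb{C}[\mathcal{S}])$ means that there is an isomorphism of affine varieties under which each $\chi^m\in\mathbb{C}[\mathcal{S}]$ becomes a regular function on $V$ that restricts to the character $\chi^m$ on $T$, and $\simeq$ denotes isomorphism of affine varieties. Moreover, conditions 1, 2 and 3 are also equivalent to condition 2 with $=$ replaced by $\simeq$, and to condition 3 with $\simeq$ replaced by $=$. -/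

import Mathlib

open MvPolynomial TensorProduct

noncomputable section

namespace AffineToric

/-! ### Affine varieties and regular maps -/

/-- An affine variety in `ℂ^s`: the common zero set of finitely many polynomials. -/
def IsAffineVariety {s : ℕ} (V : Set (Fin s → ℂ)) : Prop :=
  ∃ F : Finset (MvPolynomial (Fin s) ℂ), V = {x | ∀ f ∈ F, eval x f = 0}

/-- Irreducibility in the Zariski topology. -/
def IsIrreducibleVariety {s : ℕ} (V : Set (Fin s → ℂ)) : Prop :=
  V.Nonempty ∧ ∀ Z₁ Z₂ : Set (Fin s → ℂ), IsAffineVariety Z₁ → IsAffineVariety Z₂ →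
    V ⊆ Z₁ ∪ Z₂ → V ⊆ Z₁ ∨ V ⊆ Z₂

/-- `T ⊆ V` is Zariski open in `V`. -/
def IsZariskiOpenIn {s : ℕ} (V T : Set (Fin s → ℂ)) : Prop :=
  ∃ Z : Set (Fin s → ℂ), IsAffineVariety Z ∧ T = V \ Z

/-- `T ⊆ V` is Zariski dense in `V`. -/
def IsZariskiDenseIn {s : ℕ} (V T : Set (Fin s → ℂ)) : Prop :=
  ∀ Z : Set (Fin s → ℂ), IsAffineVariety Z → T ⊆ Z → V ⊆ Z

/-- Let `X` be a quasi-affine variety, given by the coordinates `c : X → ℂ^ι` of its points.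
A function on `X` is regular if near every point (on a basic Zariski open neighbourhood) it is a
quotient of two polynomials in the coordinates. -/
def IsRegularFun {X ι : Type*} (c : X → ι → ℂ) (f : X → ℂ) : Prop :=
  ∀ x : X, ∃ p q : MvPolynomial ι ℂ, eval (c x) q ≠ 0 ∧
    ∀ y : X, eval (c y) q ≠ 0 → f y = eval (c y) p / eval (c y) q

/-- A map of quasi-affine varieties (given by coordinates `c` and `d`) is a morphism if all its
coordinate functions are regular. -/
def IsRegularMap {X Y ι κ : Type*} (c : X → ι → ℂ) (d : Y → κ → ℂ) (f : X → Y) : Prop :=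
  ∀ j : κ, IsRegularFun c (fun x => d (f x) j)

/-- The coordinates of a point of a subset of `ℂ^s`. -/
def coords {s : ℕ} (V : Set (Fin s → ℂ)) : V → Fin s → ℂ := fun x => x.1

/-- The coordinates of a point of `(ℂ^*)^n`, an open subset of `ℂ^n`. -/
def torusCoords (n : ℕ) : (Fin n → ℂˣ) → Fin n → ℂ := fun t i => (t i : ℂ)

/-- The coordinates of a point of a product. -/
def prodCoords {X Y ι κ : Type*} (c : X → ι → ℂ) (d : Y → κ → ℂ) : X × Y → ι ⊕ κ → ℂ :=
  fun z => Sum.elim (c z.1) (d z.2)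

/-- The coordinate ring `ℂ[V] = ℂ[x₁, …, x_s] / I(V)`. -/
abbrev CoordRing {s : ℕ} (V : Set (Fin s → ℂ)) : Type :=
  MvPolynomial (Fin s) ℂ ⧸ vanishingIdeal ℂ V

/-- The value of an element of the coordinate ring at a point of `V`. -/
def evalAt {s : ℕ} {V : Set (Fin s → ℂ)} (x : V) : CoordRing V →ₐ[ℂ] ℂ :=
  Ideal.Quotient.liftₐ (vanishingIdeal ℂ V) (aeval x.1) (fun _ hp => hp x.1 x.2)

/-- An irreducible affine variety is normal if its coordinate ring (a domain) is integrally closed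
in its field of fractions. -/
def IsNormalVariety {s : ℕ} (V : Set (Fin s → ℂ)) : Prop :=
  IsIntegrallyClosed (CoordRing V)

/-- An isomorphism of affine varieties `V ≃ Specm R`: a homeomorphism `V ≃ Specm R` for the Zariski
topologies together with an isomorphism of `ℂ`-algebras `R ≃ ℂ[V]`, such that an element of `R`
vanishes at a point of `Specm R` (that is, lies in that maximal ideal) if and only if the
corresponding function vanishes at the corresponding point of `V`. -/
structure SpecmIso {s : ℕ} (V : Set (Fin s → ℂ)) (R : Type*) [CommRing R] [Algebra ℂ R] where
  toAlgEquiv : R ≃ₐ[ℂ] CoordRing V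
  toEquiv : V ≃ MaximalSpectrum R
  isClosed_image_iff : ∀ Z : Set (Fin s → ℂ), Z ⊆ V →
    (IsClosed (toEquiv '' {x : V | x.1 ∈ Z}) ↔ IsAffineVariety Z)
  mem_iff : ∀ (x : V) (r : R), r ∈ (toEquiv x).asIdeal ↔ evalAt x (toAlgEquiv r) = 0

/-! ### Affine toric varieties -/

/-- An affine toric variety in `ℂ^s`: an irreducible affine variety `V` containing a torus `T` as a
Zariski dense open subset such that the action of `T` on itself extends to an algebraic action of
`T` on `V`. -/
structure AffineToricVariety (s : ℕ) where
  V : Set (Fin s → ℂ)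
  isAffineVariety : IsAffineVariety V
  irreducible : IsIrreducibleVariety V
  T : Set (Fin s → ℂ)
  subset : T ⊆ V
  isOpen : IsZariskiOpenIn V T
  dense : IsZariskiDenseIn V T
  /-- the group structure of the torus -/
  [group : Group T]
  /-- `T` is a torus: it is isomorphic to some `(ℂ^*)^n`, as a variety and as a group. -/
  torus : ∃ (n : ℕ) (φ : (Fin n → ℂˣ) ≃* T),
    IsRegularMap (torusCoords n) (coords T) φ ∧ IsRegularMap (coords T) (torusCoords n) φ.symm
  /-- The multiplication of `T` extends to an action `T × V → V` that is a morphism. -/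
  action : ∃ act : T × V → V,
    IsRegularMap (prodCoords (coords T) (coords V)) (coords V) act ∧
    (∀ x : V, act (1, x) = x) ∧
    (∀ (t t' : T) (x : V), act (t * t', x) = act (t, act (t', x))) ∧
    ∀ t t' : T, act (t, ⟨t'.1, subset t'.2⟩) = ⟨(t * t').1, subset (t * t').2⟩

attribute [instance] AffineToricVariety.group

theorem isRegularFun_one {X ι : Type*} (c : X → ι → ℂ) : IsRegularFun c (fun _ => 1) :=
  fun _ => ⟨1, 1, by simp, fun y _ => by simp⟩

theorem IsRegularFun.mul {X ι : Type*} {c : X → ι → ℂ} {f g : X → ℂ} (hf : IsRegularFun c f)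
    (hg : IsRegularFun c g) : IsRegularFun c (fun x => f x * g x) := by
  intro x
  obtain ⟨p, q, hq, h⟩ := hf x
  obtain ⟨p', q', hq', h'⟩ := hg x
  refine ⟨p * p', q * q', by simp [hq, hq'], fun y hy => ?_⟩
  rw [map_mul] at hy
  change f y * g y = _
  rw [h y (left_ne_zero_of_mul hy), h' y (right_ne_zero_of_mul hy), map_mul, map_mul,
    div_mul_div_comm]

theorem IsRegularFun.inv {X ι : Type*} {c : X → ι → ℂ} {f : X → ℂ} (hf : IsRegularFun c f)
    (h0 : ∀ x, f x ≠ 0) : IsRegularFun c (fun x => (f x)⁻¹) := by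
  intro x
  obtain ⟨p, q, hq, h⟩ := hf x
  have hp : eval (c x) p ≠ 0 := fun hp => h0 x (by rw [h x hq, hp, zero_div])
  refine ⟨q * q, p * q, by simp [hq, hp], fun y hy => ?_⟩
  rw [map_mul] at hy
  have hqy := right_ne_zero_of_mul hy
  have hpy := left_ne_zero_of_mul hy
  change (f y)⁻¹ = _
  rw [h y hqy, map_mul, map_mul]
  field_simp

namespace AffineToricVariety

variable {s : ℕ} (X : AffineToricVariety s)

/-- The group of characters of the torus: morphisms `T → ℂ^*` that are group homomorphisms. -/
def characterGroup : Subgroup (X.T →* ℂˣ) where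
  carrier := {χ | IsRegularFun (coords X.T) (fun t => (χ t : ℂ))}
  one_mem' := by simpa using isRegularFun_one (coords X.T)
  mul_mem' {χ ψ} hχ hψ := by simpa using IsRegularFun.mul hχ hψ
  inv_mem' {χ} hχ := by simpa using IsRegularFun.inv hχ (fun t => (χ t).ne_zero)

/-- The character lattice `M` of the torus, written additively. -/
abbrev M : Type := Additive X.characterGroup

/-- The character `χ^m : T → ℂ^*` of a lattice point `m ∈ M`. -/
def char (m : X.M) : X.T →* ℂˣ := (Additive.toMul m).1

/-- The cocharacter lattice `N = Hom_ℤ(M, ℤ)`. -/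
abbrev N : Type := Module.Dual ℤ X.M

/-- `N_ℝ = ℝ ⊗ N`. -/
abbrev NReal : Type := ℝ ⊗[ℤ] X.N

/-- `M_ℝ = Hom_ℝ(N_ℝ, ℝ)`. -/
abbrev MReal : Type := Module.Dual ℝ X.NReal

/-- The canonical map `M → M_ℝ`; it sends `m` to the linear form `a ⊗ u ↦ a * ⟨m, u⟩`. -/
def toMReal : X.M →+ X.MReal where
  toFun m := TensorProduct.AlgebraTensorModule.lift
    ((LinearMap.lsmul ℝ (X.N →ₗ[ℤ] ℝ)).flip
      ((Algebra.linearMap ℤ ℝ).comp (Module.Dual.eval ℤ X.M m)))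
  map_zero' := by ext u; simp
  map_add' m m' := by ext u; simp

theorem toMReal_tmul (m : X.M) (a : ℝ) (u : X.N) : X.toMReal m (a ⊗ₜ[ℤ] u) = a * (u m : ℤ) := by
  simp [toMReal]

/-- A rational (convex polyhedral) cone in `N_ℝ`: the cone generated by a finite subset of `N`. -/
def IsRationalCone (σ : PointedCone ℝ X.NReal) : Prop :=
  ∃ S : Finset X.N, σ = PointedCone.hull ℝ ((fun u : X.N => (1 : ℝ) ⊗ₜ[ℤ] u) '' S)

/-- Strong convexity: `σ ∩ (-σ) = {0}`. -/
def IsStronglyConvex (σ : PointedCone ℝ X.NReal) : Prop :=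
  {x : X.NReal | x ∈ σ ∧ -x ∈ σ} = {0}

/-- The dual cone `σ^∨` in `M_ℝ`. -/
def dualCone (σ : PointedCone ℝ X.NReal) : PointedCone ℝ X.MReal :=
  PointedCone.dual (Module.Dual.eval ℝ X.NReal) (σ : Set X.NReal)

/-- The semigroup `S_σ = σ^∨ ∩ M`. -/
def coneSemigroup (σ : PointedCone ℝ X.NReal) : AddSubmonoid X.M :=
  (X.dualCone σ).toAddSubmonoid.comap X.toMReal

/-- A saturated affine semigroup in `M`: a finitely generated submonoid `S` of `M` such that
`k m ∈ S` with `k > 0` and `m ∈ M` implies `m ∈ S`. -/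
def IsSaturatedAffineSemigroup (S : AddSubmonoid X.M) : Prop :=
  S.FG ∧ ∀ (k : ℕ) (m : X.M), 0 < k → k • m ∈ S → m ∈ S

/-- `V ≃ Specm ℂ[S]`: the two affine varieties are isomorphic. -/
def IsoSpecm (S : AddSubmonoid X.M) : Prop :=
  Nonempty (SpecmIso X.V (AddMonoidAlgebra ℂ S))

/-- `V = Specm ℂ[S]`: the affine varieties are identified in such a way that each element `χ^m` of
`ℂ[S]`, `m ∈ S`, is a regular function on `V` whose restriction to `T` is the character `χ^m`. -/
def EqSpecm (S : AddSubmonoid X.M) : Prop :=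
  ∃ e : SpecmIso X.V (AddMonoidAlgebra ℂ S), ∀ (m : S) (t : X.T),
    evalAt ⟨t.1, X.subset t.2⟩ (e.toAlgEquiv (AddMonoidAlgebra.single m 1)) = (X.char m t : ℂ)

end AffineToricVariety

end AffineToric

end

/-!
Restricting functions to the dense torus identifies `ℂ[V]` with a translation invariant space of
linear combinations of characters. By independence of characters such a space is spanned by the
characters it contains, so `ℂ[V] = ℂ[S]` for the finitely generated semigroup `S` of the characters
that extend to `V`. The functions `q ∈ ℂ[V]` with `q χ^m ∈ ℂ[V]` also form such a space, which is
nonzero as `χ^m` is locally a quotient of polynomials; hence every `m ∈ M` is a difference of two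
elements of `S`.

If `ℂ[S]` is integrally closed and `k m ∈ S`, write `m = b - a` with `a, b ∈ S`: then `(χ^a)^k`
divides `(χ^b)^k`, so `χ^a` divides `χ^b` and `m ∈ S`. Conversely, by Farkas' lemma a saturated
affine semigroup is cut out by half-spaces `u ≥ 0`, and an element of `ℂ[M]` integral over `ℂ[S]` is
supported in each of them: a linear form `u ≥ 0` on `S` grades `ℂ[M]` by powers of a variable `t`,
and `A[t]` is integrally closed in `A[t, t⁻¹]` for every reduced ring `A`. Since the Laurent
polynomial ring `ℂ[M]` is integrally closed, so is `ℂ[S]`.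

Farkas' and Gordan's lemmas also make the saturated affine semigroups the semigroups `S_σ` of
rational cones; `S_σ` generates `M` as a group only if `σ` is strongly convex.
-/

noncomputable section

namespace AffineToric

/-! ### Regular functions -/

section Regular

variable {X Y ι κ : Type*} {c : X → ι → ℂ} {d : Y → κ → ℂ} {f g : X → ℂ}

/-- The ideal of denominators of a function `f`: the polynomials `q` such that `q f` is the
restriction of a polynomial. -/
def denominatorIdeal (c : X → ι → ℂ) (f : X → ℂ) : Ideal (MvPolynomial ι ℂ) where
  carrier := {q | ∃ p, ∀ x, eval (c x) q * f x = eval (c x) p}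
  zero_mem' := ⟨0, by simp⟩
  add_mem' := by
    rintro q q' ⟨p, hp⟩ ⟨p', hp'⟩
    exact ⟨p + p', fun x => by rw [map_add, map_add, add_mul, hp, hp']⟩
  smul_mem' := by
    rintro a q ⟨p, hp⟩
    exact ⟨a * p, fun x => by rw [smul_eq_mul, map_mul, map_mul, mul_assoc, hp]⟩

theorem isRegularFun_iff_exists_mem_denominatorIdeal :
    IsRegularFun c f ↔ ∀ x, ∃ q ∈ denominatorIdeal c f, eval (c x) q ≠ 0 := by
  refine forall_congr' fun x => ⟨?_, ?_⟩
  · rintro ⟨p, q, hq, hpq⟩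
    -- `q f = p` may fail where `q` vanishes, but `q² f = q p` holds everywhere.
    refine ⟨q * q, ⟨q * p, fun y => ?_⟩, by simpa using hq⟩
    by_cases hy : eval (c y) q = 0
    · simp [hy]
    · rw [hpq y hy, map_mul, map_mul]
      field_simp
  · rintro ⟨q, ⟨p, hpq⟩, hq⟩
    exact ⟨p, q, hq, fun y hy => eq_div_of_mul_eq hy (by rw [mul_comm, hpq])⟩

theorem isRegularFun_eval (c : X → ι → ℂ) (p : MvPolynomial ι ℂ) :
    IsRegularFun c (fun x => eval (c x) p) :=
  fun _ => ⟨p, 1, by simp, fun y _ => by simp⟩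

theorem IsRegularFun.add (hf : IsRegularFun c f) (hg : IsRegularFun c g) :
    IsRegularFun c (fun x => f x + g x) := by
  rw [isRegularFun_iff_exists_mem_denominatorIdeal] at *
  intro x
  obtain ⟨q, ⟨p, hpq⟩, hq⟩ := hf x
  obtain ⟨q', ⟨p', hpq'⟩, hq'⟩ := hg x
  refine ⟨q * q', ⟨q' * p + q * p', fun y => ?_⟩, by simp [hq, hq']⟩
  simp only [map_add, map_mul, ← hpq, ← hpq']
  ring

theorem isRegularFun_eval_of_forall {φ : X → κ → ℂ} (hφ : ∀ j, IsRegularFun c fun x => φ x j)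
    (p : MvPolynomial κ ℂ) : IsRegularFun c (fun x => eval (φ x) p) := by
  induction p using MvPolynomial.induction_on with
  | C a => simpa using isRegularFun_eval c (C a)
  | add p q hp hq => simpa using hp.add hq
  | mul_X p j hp => simpa using hp.mul (hφ j)

theorem IsRegularFun.comp {f : Y → ℂ} {φ : X → Y} (hf : IsRegularFun d f)
    (hφ : IsRegularMap c d φ) : IsRegularFun c (fun x => f (φ x)) := by
  have hpoly (p : MvPolynomial κ ℂ) : IsRegularFun c fun x => eval (d (φ x)) p :=
    isRegularFun_eval_of_forall hφ p
  simp only [isRegularFun_iff_exists_mem_denominatorIdeal] at hf hpoly ⊢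
  intro x
  obtain ⟨q, ⟨p, hpq⟩, hq⟩ := hf (φ x)
  obtain ⟨q₁, ⟨p₁, h₁⟩, hq₁⟩ := hpoly p x
  obtain ⟨q₂, ⟨p₂, h₂⟩, hq₂⟩ := hpoly q x
  refine ⟨q₁ * p₂, ⟨q₂ * p₁, fun y => ?_⟩, by simp [hq₁, ← h₂, hq₂, hq]⟩
  simp only [map_mul, ← h₁, ← h₂, ← hpq]
  ring

/-- The hypothesis `hc` says that `X` contains the complement of the hypersurface `h = 0` in its
Zariski closure. -/
theorem IsRegularFun.exists_pow_mul_eq_eval [Finite ι] (hf : IsRegularFun c f)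
    (h : MvPolynomial ι ℂ)
    (hc : ∀ y ∈ zeroLocus ℂ (vanishingIdeal ℂ (Set.range c)), eval y h ≠ 0 → y ∈ Set.range c) :
    ∃ (k : ℕ) (p : MvPolynomial ι ℂ), ∀ x, eval (c x) h ^ k * f x = eval (c x) p := by
  have le_denominatorIdeal : vanishingIdeal ℂ (Set.range c) ≤ denominatorIdeal c f := fun p hp =>
    ⟨0, fun x => by simpa [aeval_eq_eval] using Or.inl (hp (c x) ⟨x, rfl⟩)⟩
  have hmem : h ∈ vanishingIdeal ℂ (zeroLocus ℂ (denominatorIdeal c f)) := by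
    intro y hy
    by_contra hne
    obtain ⟨x, rfl⟩ := hc y (fun p hp => hy p (le_denominatorIdeal hp)) hne
    obtain ⟨q, hq, hqx⟩ := isRegularFun_iff_exists_mem_denominatorIdeal.1 hf x
    exact hqx (hy q hq)
  rw [vanishingIdeal_zeroLocus_eq_radical] at hmem
  obtain ⟨k, p, hp⟩ := hmem
  exact ⟨k, p, fun x => by simpa using hp x⟩

end Regular

section Variety

variable {s : ℕ} {V : Set (Fin s → ℂ)}

theorem isAffineVariety_zeroLocus (I : Ideal (MvPolynomial (Fin s) ℂ)) :
    IsAffineVariety (zeroLocus ℂ I) := by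
  obtain ⟨F, rfl⟩ := (isNoetherianRing_iff_ideal_fg _).1 inferInstance I
  exact ⟨F, by rw [zeroLocus_span]; simp [aeval_eq_eval]⟩

theorem IsAffineVariety.zeroLocus_vanishingIdeal_subset (hV : IsAffineVariety V) :
    zeroLocus ℂ (vanishingIdeal ℂ V) ⊆ V := by
  obtain ⟨F, rfl⟩ := hV
  exact fun y hy f hf => hy f fun x hx => hx f hf

theorem IsRegularFun.exists_eq_eval (hV : IsAffineVariety V) {f : V → ℂ}
    (hf : IsRegularFun (coords V) f) :
    ∃ p : MvPolynomial (Fin s) ℂ, ∀ x : V, f x = eval x.1 p := by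
  have hrange : Set.range (coords V) = V := Subtype.range_coe
  obtain ⟨k, p, hp⟩ := hf.exists_pow_mul_eq_eval 1 fun y hy _ => by
    rw [hrange] at hy ⊢
    exact hV.zeroLocus_vanishingIdeal_subset hy
  exact ⟨p, fun x => by simpa [coords] using hp x⟩

/-! ### Points of affine varieties and maximal ideals -/

theorem evalAt_mk (x : V) (p : MvPolynomial (Fin s) ℂ) :
    evalAt x (Ideal.Quotient.mk (vanishingIdeal ℂ V) p) = eval x.1 p := by
  simp [evalAt]

theorem evalAt_surjective (x : V) : Function.Surjective (evalAt x) :=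
  fun a => ⟨algebraMap ℂ _ a, by simp⟩

theorem exists_ker_evalAt_eq (hV : IsAffineVariety V) (I : Ideal (CoordRing V)) [I.IsMaximal] :
    ∃ x : V, RingHom.ker (evalAt x) = I := by
  obtain ⟨y, hy⟩ := eq_vanishingIdeal_singleton_of_isMaximal ℂ
    (Ideal.comap_isMaximal_of_surjective (Ideal.Quotient.mk (vanishingIdeal ℂ V))
      Ideal.Quotient.mk_surjective (K := I))
  have mk_mem_iff (p) : Ideal.Quotient.mk (vanishingIdeal ℂ V) p ∈ I ↔ eval y p = 0 := by
    rw [← Ideal.mem_comap, hy, mem_vanishingIdeal_singleton_iff, aeval_eq_eval]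
  have hyV : y ∈ V := hV.zeroLocus_vanishingIdeal_subset fun p hp => by
    rw [aeval_eq_eval, ← mk_mem_iff, Ideal.Quotient.eq_zero_iff_mem.2 hp]
    exact I.zero_mem
  refine ⟨⟨y, hyV⟩, Ideal.ext fun r => ?_⟩
  obtain ⟨p, rfl⟩ := Ideal.Quotient.mk_surjective r
  rw [mk_mem_iff, RingHom.mem_ker, evalAt_mk]

theorem isAffineVariety_setOf_forall_evalAt_eq_zero (hV : IsAffineVariety V)
    (A : Set (CoordRing V)) :
    IsAffineVariety {y | ∃ hy : y ∈ V, ∀ r ∈ A, evalAt ⟨y, hy⟩ r = 0} := by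
  convert isAffineVariety_zeroLocus ((Ideal.span A).comap (Ideal.Quotient.mk _)) using 1
  ext y
  constructor
  · rintro ⟨hy, hyA⟩ p hp
    have hspan : Ideal.span A ≤ RingHom.ker (evalAt ⟨y, hy⟩) := Ideal.span_le.2 hyA
    simpa only [RingHom.mem_ker, evalAt_mk, ← aeval_eq_eval] using hspan hp
  · intro hy
    have hyV : y ∈ V := hV.zeroLocus_vanishingIdeal_subset fun p hp => hy p <| by
      rw [Ideal.mem_comap, Ideal.Quotient.eq_zero_iff_mem.2 hp]
      exact zero_mem _
    refine ⟨hyV, fun r hr => ?_⟩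
    obtain ⟨p, rfl⟩ := Ideal.Quotient.mk_surjective r
    rw [evalAt_mk, ← aeval_eq_eval]
    exact hy p (Ideal.subset_span hr)

variable {R : Type*} [CommRing R] [Algebra ℂ R]

/-- The maximal ideal of a point of `V`, in a ring identified with `ℂ[V]`. -/
def pointIdeal (e : R ≃ₐ[ℂ] CoordRing V) (x : V) : MaximalSpectrum R :=
  ⟨RingHom.ker ((evalAt x).comp (e : R →ₐ[ℂ] CoordRing V)),
    RingHom.ker_isMaximal_of_surjective _ ((evalAt_surjective x).comp e.surjective)⟩

theorem mem_pointIdeal (e : R ≃ₐ[ℂ] CoordRing V) (x : V) (r : R) :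
    r ∈ (pointIdeal e x).asIdeal ↔ evalAt x (e r) = 0 := by
  simp [pointIdeal, RingHom.mem_ker]

theorem pointIdeal_injective (e : R ≃ₐ[ℂ] CoordRing V) : Function.Injective (pointIdeal e) := by
  intro x y hxy
  ext i
  have h : e.symm (Ideal.Quotient.mk _ (X i - C (x.1 i))) ∈ (pointIdeal e x).asIdeal := by
    rw [mem_pointIdeal, e.apply_symm_apply, evalAt_mk]
    simp
  rw [hxy, mem_pointIdeal, e.apply_symm_apply, evalAt_mk] at h
  simpa [sub_eq_zero, eq_comm (a := x.1 i)] using h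

theorem pointIdeal_surjective (hV : IsAffineVariety V) (e : R ≃ₐ[ℂ] CoordRing V) :
    Function.Surjective (pointIdeal e) := by
  intro m
  have : (m.asIdeal.comap (e.symm : CoordRing V →+* R)).IsMaximal :=
    haveI := m.isMaximal
    Ideal.comap_isMaximal_of_surjective _ e.symm.surjective
  obtain ⟨x, hx⟩ := exists_ker_evalAt_eq hV (m.asIdeal.comap (e.symm : CoordRing V →+* R))
  refine ⟨x, MaximalSpectrum.ext (Ideal.ext fun r => ?_)⟩
  rw [mem_pointIdeal, ← RingHom.mem_ker, hx, Ideal.mem_comap]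
  simp

theorem pointIdeal_mem_zeroLocus_iff (e : R ≃ₐ[ℂ] CoordRing V) (A : Set R) (x : V) :
    (pointIdeal e x).toPrimeSpectrum ∈ PrimeSpectrum.zeroLocus A ↔
      ∀ r ∈ A, evalAt x (e r) = 0 := by
  simp only [PrimeSpectrum.mem_zeroLocus, ← mem_pointIdeal]
  rfl

theorem isClosed_image_pointIdeal_iff (hV : IsAffineVariety V) (e : R ≃ₐ[ℂ] CoordRing V)
    {Z : Set (Fin s → ℂ)} (hZ : Z ⊆ V) :
    IsClosed (pointIdeal e '' {x : V | x.1 ∈ Z}) ↔ IsAffineVariety Z := by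
  rw [isClosed_induced_iff]
  constructor
  · rintro ⟨C, hC, hCZ⟩
    obtain ⟨A, rfl⟩ := (PrimeSpectrum.isClosed_iff_zeroLocus C).1 hC
    have mem_iff (x : V) : x.1 ∈ Z ↔ ∀ r ∈ A, evalAt x (e r) = 0 := by
      rw [← pointIdeal_mem_zeroLocus_iff, ← Set.mem_preimage (f := MaximalSpectrum.toPrimeSpectrum),
        hCZ, (pointIdeal_injective e).mem_set_image, Set.mem_ofPred_eq]
    convert isAffineVariety_setOf_forall_evalAt_eq_zero hV (e '' A) using 1
    ext y
    exact ⟨fun hy => ⟨hZ hy, by simpa using (mem_iff ⟨y, hZ hy⟩).1 hy⟩,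
      fun ⟨hyV, hy⟩ => (mem_iff ⟨y, hyV⟩).2 (by simpa using hy)⟩
  · rintro ⟨F, rfl⟩
    refine ⟨PrimeSpectrum.zeroLocus ((fun f => e.symm (Ideal.Quotient.mk _ f)) '' F),
      PrimeSpectrum.isClosed_zeroLocus _, ?_⟩
    ext m
    obtain ⟨x, rfl⟩ := pointIdeal_surjective hV e m
    rw [Set.mem_preimage, pointIdeal_mem_zeroLocus_iff, (pointIdeal_injective e).mem_set_image]
    simp [evalAt_mk]

/-- The identification of an affine variety with the maximal spectrum of a ring isomorphic to its
coordinate ring. -/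
def SpecmIso.ofAlgEquiv (hV : IsAffineVariety V) (e : R ≃ₐ[ℂ] CoordRing V) : SpecmIso V R where
  toAlgEquiv := e
  toEquiv := Equiv.ofBijective (pointIdeal e) ⟨pointIdeal_injective e, pointIdeal_surjective hV e⟩
  isClosed_image_iff _ hZ := isClosed_image_pointIdeal_iff hV e hZ
  mem_iff := mem_pointIdeal e

end Variety

/-! ### Saturated semigroups and duality over `ℤ` -/

section Lattice

open PointedCone

variable {L L' : Type*} [AddCommGroup L] [AddCommGroup L']

/-- A submonoid `S` of a group is saturated if it contains every element having a positive multiple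
in `S`. -/
def IsSaturated (S : AddSubmonoid L) : Prop :=
  ∀ (k : ℕ) (m : L), 0 < k → k • m ∈ S → m ∈ S

theorem zsmul_mem_of_nonneg {S : AddSubmonoid L} {k : ℤ} {m : L} (hk : 0 ≤ k) (hm : m ∈ S) :
    k • m ∈ S := by
  lift k to ℕ using hk
  simpa using nsmul_mem hm k

theorem IsSaturated.mem_of_zsmul_mem {S : AddSubmonoid L} (hS : IsSaturated S) {k : ℤ} {m : L}
    (hk : 0 < k) (hm : k • m ∈ S) : m ∈ S := by
  lift k to ℕ using hk.le
  exact hS k m (by simpa using hk) (by simpa using hm)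

theorem fg_comap_nonneg {G κ : Type*} [AddCommMonoid G] [AddMonoid.FG G] [Finite κ]
    (u : G →+ (κ → ℤ)) : ((AddSubmonoid.nonneg (κ → ℤ)).comap u).FG := by
  have : Module.Finite ℕ G := Module.Finite.iff_addMonoid_fg.2 ‹_›
  obtain ⟨n, π, hπ⟩ := Module.Finite.exists_fin' ℕ G
  let f : (Fin n → ℕ) × (κ → ℕ) →+ (κ → ℤ) :=
    (u.comp π.toAddMonoidHom).comp (AddMonoidHom.fst _ _)
  let g : (Fin n → ℕ) × (κ → ℕ) →+ (κ → ℤ) :=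
    ((Nat.castAddMonoidHom ℤ).compLeft κ).comp (AddMonoidHom.snd _ _)
  -- The slack variables in `κ → ℕ` turn the inequalities into equations over `ℕ`.
  have slack : (AddSubmonoid.nonneg (κ → ℤ)).comap u =
      (f.eqLocusM g).map (π.toAddMonoidHom.comp (AddMonoidHom.fst _ _)) := by
    ext x
    constructor
    · intro hx
      obtain ⟨a, rfl⟩ := hπ x
      exact ⟨(a, fun j => (u (π a) j).toNat),
        funext fun j => (Int.toNat_of_nonneg (hx j)).symm, rfl⟩
    · rintro ⟨⟨a, b⟩, hab, rfl⟩ j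
      exact (congrFun hab j).symm ▸ Int.natCast_nonneg (b j)
  rw [slack]
  exact (AddSubmonoid.fg_eqLocusM f g).map _

/-- **Gordan's lemma** -/
theorem fg_toAddSubmonoid_dual [Module.Finite ℤ L'] (p : L →ₗ[ℤ] L' →ₗ[ℤ] ℤ) {A : Set L}
    (hA : A.Finite) : (dual p A).toAddSubmonoid.FG := by
  have := hA.to_subtype
  have : AddMonoid.FG L' := AddGroup.fg_iff_addMonoid_fg.1 (Module.Finite.iff_addGroup_fg.1 ‹_›)
  have eq_comap : (dual p A).toAddSubmonoid = (AddSubmonoid.nonneg (A → ℤ)).comap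
      (AddMonoidHom.pi fun u : A => (p u).toAddMonoidHom) := by
    ext m
    simp [Pi.le_def]
  exact eq_comap ▸ fg_comap_nonneg _

theorem isSaturated_toAddSubmonoid_dual (p : L →ₗ[ℤ] L' →ₗ[ℤ] ℤ) (A : Set L) :
    IsSaturated (dual p A).toAddSubmonoid := by
  intro k m hk hkm u hu
  have := hkm hu
  rw [map_nsmul, nsmul_eq_mul] at this
  exact nonneg_of_mul_nonneg_right this (by exact_mod_cast hk)

theorem dual_addSubmonoidClosure (p : L →ₗ[ℤ] L' →ₗ[ℤ] ℤ) (A : Set L) :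
    dual p (AddSubmonoid.closure A) = dual p A := by
  refine le_antisymm (dual_anti AddSubmonoid.subset_closure) fun u hu => ?_
  have : AddSubmonoid.closure A ≤ (dual p.flip {u}).toAddSubmonoid :=
    AddSubmonoid.closure_le.2 fun x hx => by simpa using hu hx
  intro x hx
  simpa using this hx

/-- **Farkas' lemma** over the integers -/
theorem IsSaturated.exists_dual_neg [Module.Free ℤ L] {S : AddSubmonoid L} (hS : IsSaturated S)
    {ι : Type*} (t : Finset ι) (v : ι → L) (hv : ∀ i ∈ t, v i ∈ S) {w : L} (hw : w ∉ S) :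
    ∃ u : Module.Dual ℤ L, (∀ i ∈ t, 0 ≤ u (v i)) ∧ u w < 0 := by
  classical
  induction t using Finset.induction_on generalizing v w with
  | empty =>
    obtain ⟨u, hu⟩ : ∃ u : Module.Dual ℤ L, u w ≠ 0 := by
      by_contra! h
      exact hw ((Module.forall_dual_apply_eq_zero_iff ℤ w).1 h ▸ zero_mem S)
    rcases hu.lt_or_gt with h | h
    · exact ⟨u, by simp, h⟩
    · exact ⟨-u, by simp, by simpa using h⟩
  | insert a t _ ih =>
    obtain ⟨hva, hvt⟩ := Finset.forall_mem_insert _ _ _ |>.1 hv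
    obtain ⟨f, hf, hfw⟩ := ih v hvt hw
    by_cases! hfa : 0 ≤ f (v a)
    · exact ⟨f, by simpa [hfa] using hf, hfw⟩
    -- Project along `v a` to the hyperplane `f = 0`, up to the positive factor `-f (v a)`.
    let r : L →ₗ[ℤ] L := LinearMap.toSpanSingleton ℤ L (v a) ∘ₗ f - f (v a) • LinearMap.id
    have hr (x) : r x = f x • v a + (-f (v a)) • x := by simp [r, sub_eq_add_neg]
    have hrv : ∀ i ∈ t, r (v i) ∈ S := fun i hi => by
      rw [hr]
      exact add_mem (zsmul_mem_of_nonneg (hf i hi) hva)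
        (zsmul_mem_of_nonneg (by omega) (hvt i hi))
    have hrw : r w ∉ S := fun h => by
      refine hw (hS.mem_of_zsmul_mem (k := -f (v a)) (by omega) ?_)
      rw [show (-f (v a)) • w = r w + (-f w) • v a by rw [hr]; module]
      exact add_mem h (zsmul_mem_of_nonneg (by omega) hva)
    obtain ⟨g, hg, hgw⟩ := ih (fun i => r (v i)) hrv hrw
    exact ⟨g ∘ₗ r, Finset.forall_mem_insert _ _ _ |>.2 ⟨by simp [r], hg⟩, hgw⟩

theorem IsSaturated.dual_flip_dual_eq [Module.Free ℤ L] {S : AddSubmonoid L} (hS : IsSaturated S)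
    (hfg : S.FG) :
    (dual (Module.Dual.eval ℤ L).flip (dual (Module.Dual.eval ℤ L) S)).toAddSubmonoid = S := by
  refine le_antisymm (fun w hw => ?_) subset_dual_dual
  obtain ⟨t, rfl⟩ := hfg
  by_contra hwS
  obtain ⟨u, hu, huw⟩ := hS.exists_dual_neg t id (fun _ hi => AddSubmonoid.subset_closure hi) hwS
  rw [dual_addSubmonoidClosure] at hw
  exact huw.not_ge (hw fun i hi => hu i hi)

end Lattice

/-! ### Normality of semigroup algebras -/

section SemigroupAlgebra

open AddMonoidAlgebra LaurentPolynomial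

theorem X_dvd_of_isIntegral_of_toLaurent_eq_mul_T {A : Type*} [CommRing A] [IsReduced A]
    {x : LaurentPolynomial A} (hx : IsIntegral (Polynomial A) x) {p : Polynomial A} {n : ℕ}
    (hp : Polynomial.toLaurent p = x * T (n + 1 : ℕ)) : Polynomial.X ∣ p := by
  nontriviality A
  obtain ⟨q, hq, hqx⟩ := hx
  replace hqx : q.eval₂ Polynomial.toLaurent x = 0 := hqx
  have hroot : (q.scaleRoots (Polynomial.X ^ (n + 1))).eval p = 0 := by
    refine Polynomial.toLaurent_injective ?_
    rw [← Polynomial.eval₂_hom, hp, mul_comm, ← Polynomial.toLaurent_X_pow,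
      Polynomial.scaleRoots_eval₂_mul, hqx, mul_zero, map_zero]
  -- Modulo `X` only the leading term of the integral equation survives.
  have hcoeff : p.coeff 0 ^ q.natDegree = 0 := by
    have h := congrArg (Polynomial.evalRingHom 0) hroot
    rw [← Polynomial.eval_map_apply, Polynomial.map_scaleRoots _ _ _ (by simp [hq])] at h
    simpa [(hq.map _).leadingCoeff, hq.natDegree_map, Polynomial.coeff_zero_eq_eval_zero] using h
  exact Polynomial.X_dvd_iff.2 (IsNilpotent.eq_zero ⟨_, hcoeff⟩)

instance {A : Type*} [CommRing A] [IsReduced A] :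
    IsIntegrallyClosedIn (Polynomial A) (LaurentPolynomial A) := by
  refine isIntegrallyClosedIn_iff.2 ⟨Polynomial.toLaurent_injective, fun {x} hx => ?_⟩
  obtain ⟨n, p, hp⟩ := x.exists_T_pow
  induction n generalizing p with
  | zero => exact ⟨p, by simpa using hp⟩
  | succ n ih =>
    obtain ⟨p, rfl⟩ := X_dvd_of_isIntegral_of_toLaurent_eq_mul_T hx hp
    refine ih p ((isUnit_T 1).mul_left_cancel ?_)
    rw [← Polynomial.toLaurent_X, ← map_mul, hp, Polynomial.toLaurent_X, mul_left_comm, ← T_add,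
      Nat.cast_succ, add_comm]

/-- The algebra map `χ^m ↦ χ^m T^{u m}`, which encodes the grading of the semigroup algebra by a
linear form `u`. -/
def gradingHom (R : Type*) {G : Type*} [CommRing R] [AddCommMonoid G] (u : G →+ ℤ) :
    AddMonoidAlgebra R G →ₐ[R] LaurentPolynomial (AddMonoidAlgebra R G) :=
  AddMonoidAlgebra.lift R _ G
    { toFun m := single (u m.toAdd) (single m.toAdd 1)
      map_one' := by simp only [toAdd_one, map_zero, ← AddMonoidAlgebra.one_def]
      map_mul' m m' := by simp only [toAdd_mul, map_add, single_mul_single, mul_one] }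

theorem gradingHom_single {R G : Type*} [CommRing R] [AddCommMonoid G] (u : G →+ ℤ) (m : G)
    (a : R) : gradingHom R u (single m a) = single (u m) (single m a) := by
  simp [gradingHom, -single_eq_C_mul_T, smul_single]

theorem coeff_coeff_gradingHom {R G : Type*} [CommRing R] [AddCommMonoid G] (u : G →+ ℤ)
    (x : AddMonoidAlgebra R G) (m : G) :
    ((gradingHom R u x).coeff (u m)).coeff m = x.coeff m := by
  classical
  induction x using AddMonoidAlgebra.induction_linear with
  | zero => simp
  | add x y hx hy => simp [hx, hy]
  | single m' a =>
    rw [gradingHom_single]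
    simp only [coeff_single, Finsupp.single_apply]
    split_ifs <;> simp_all

theorem exists_toLaurent_comp_eq_gradingHom_comp {R G : Type*} [CommRing R] [AddCommMonoid G]
    {S : AddSubmonoid G} {u : G →+ ℤ} (hu : ∀ m ∈ S, 0 ≤ u m) :
    ∃ φ : AddMonoidAlgebra R S →+* Polynomial (AddMonoidAlgebra R G),
      Polynomial.toLaurent.comp φ =
        (gradingHom R u).toRingHom.comp (mapDomainRingHom R S.subtype) := by
  have toNat_add (m m' : S) : (u (m + m')).toNat = (u m).toNat + (u m').toNat := by
    rw [map_add, Int.toNat_add (hu m m.2) (hu m' m'.2)]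
  let φ := AddMonoidAlgebra.lift R (Polynomial (AddMonoidAlgebra R G)) S
    { toFun m := Polynomial.monomial (u m.toAdd).toNat (single (m.toAdd : G) 1)
      map_one' := by simp [← AddMonoidAlgebra.one_def]
      map_mul' m m' := by
        simp only [toAdd_mul, AddSubmonoid.coe_add, toNat_add, Polynomial.monomial_mul_monomial,
          single_mul_single, mul_one] }
  refine ⟨φ, ?_⟩
  have toLaurent_monomial (n : ℕ) (y : AddMonoidAlgebra R G) :
      Polynomial.toLaurent (Polynomial.monomial n y) = single (n : ℤ) y := by
    rw [← Polynomial.C_mul_X_pow_eq_monomial, Polynomial.toLaurent_C_mul_X_pow, single_eq_C_mul_T]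
  refine AddMonoidAlgebra.ringHom_ext (fun a => ?_) fun m => ?_
  · simp [φ, gradingHom_single]
  · simp [φ, gradingHom_single, toLaurent_monomial, -single_eq_C_mul_T, hu m m.2]

theorem nonneg_of_isIntegralElem {R G : Type*} [CommRing R] [AddCommMonoid G]
    [IsReduced (AddMonoidAlgebra R G)] {S : AddSubmonoid G} {u : G →+ ℤ} (hu : ∀ m ∈ S, 0 ≤ u m)
    {x : AddMonoidAlgebra R G} (hx : (mapDomainRingHom R S.subtype).IsIntegralElem x) {m : G}
    (hm : m ∈ x.coeff.support) : 0 ≤ u m := by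
  have hint : IsIntegral (Polynomial (AddMonoidAlgebra R G)) (gradingHom R u x) := by
    obtain ⟨φ, hφ⟩ := exists_toLaurent_comp_eq_gradingHom_comp (R := R) hu
    have h := hx.map (gradingHom R u).toRingHom
    rw [← hφ] at h
    exact h.of_comp
  obtain ⟨p, hp⟩ := IsIntegrallyClosedIn.isIntegral_iff.1 hint
  rw [algebraMap_eq_toLaurent] at hp
  by_contra! hneg
  rw [Finsupp.mem_support_iff, ← coeff_coeff_gradingHom u, ← hp, coeff_toLaurent,
    Finsupp.mapDomain_of_notMem_range] at hm
  · exact hm rfl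
  · rintro ⟨n, hn⟩
    exact hneg.not_ge (hn ▸ Int.natCast_nonneg n)

instance {R : Type*} [CommRing R] [IsDomain R] [IsIntegrallyClosed R] :
    IsIntegrallyClosed (LaurentPolynomial R) :=
  isIntegrallyClosed_of_isLocalization _ (Submonoid.powers (Polynomial.X : Polynomial R))
    (powers_le_nonZeroDivisors_of_noZeroDivisors Polynomial.X_ne_zero)

theorem isIntegrallyClosed_addMonoidAlgebra_pi (R : Type*) [CommRing R] [IsDomain R]
    [IsIntegrallyClosed R] (n : ℕ) : IsIntegrallyClosed (AddMonoidAlgebra R (Fin n → ℤ)) := by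
  induction n with
  | zero => exact .of_equiv (uniqueRingEquiv (R := R) (Fin 0 → ℤ)).symm
  | succ n ih =>
    let split : LaurentPolynomial (AddMonoidAlgebra R (Fin n → ℤ)) ≃+*
        AddMonoidAlgebra R (Fin (n + 1) → ℤ) :=
      curryRingEquiv.symm.trans
        (mapDomainRingEquiv R (Fin.consLinearEquiv ℤ fun _ => ℤ).toAddEquiv)
    exact .of_equiv split

variable {R L : Type*} [CommRing R] [AddCommGroup L]

instance [Module.Free ℤ L] : UniqueSums L :=
  .of_injective_addHom (Module.Free.chooseBasis ℤ L).repr.toAddMonoidHom.toAddHom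
    (Module.Free.chooseBasis ℤ L).repr.injective inferInstance

instance {G : Type*} [AddZeroClass G] [UniqueSums G] (S : AddSubmonoid G) : UniqueSums S :=
  .of_injective_addHom S.subtype.toAddHom Subtype.val_injective inferInstance

instance [IsDomain R] [IsIntegrallyClosed R] [Module.Free ℤ L] [Module.Finite ℤ L] :
    IsIntegrallyClosed (AddMonoidAlgebra R L) :=
  haveI := isIntegrallyClosed_addMonoidAlgebra_pi R (Module.finrank ℤ L)
  .of_equiv (mapDomainRingEquiv R (Module.finBasis ℤ L).equivFun.toAddEquiv.symm)

theorem isIntegrallyClosed_of_isSaturated [IsDomain R] [IsIntegrallyClosed R] [Module.Free ℤ L]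
    [Module.Finite ℤ L] {S : AddSubmonoid L} (hS : IsSaturated S) (hfg : S.FG) :
    IsIntegrallyClosed (AddMonoidAlgebra R S) := by
  algebraize [mapDomainRingHom R S.subtype]
  have hinj : Function.Injective (mapDomainRingHom R S.subtype) :=
    mapDomain_injective Subtype.val_injective
  have := (faithfulSMul_iff_algebraMap_injective (AddMonoidAlgebra R S) (AddMonoidAlgebra R L)).2
    hinj
  have : IsIntegrallyClosedIn (AddMonoidAlgebra R S) (AddMonoidAlgebra R L) := by
    refine isIntegrallyClosedIn_iff.2 ⟨hinj, fun {x} hx => ?_⟩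
    have support_subset (m) (hm : m ∈ x.coeff.support) : m ∈ S := by
      rw [← hS.dual_flip_dual_eq hfg]
      intro u hu
      exact nonneg_of_isIntegralElem (u := u.toAddMonoidHom) (fun m hm => hu hm) hx hm
    exact ⟨_, mapDomain_comapDomain (by simpa [Set.subset_def] using support_subset)
      Subtype.val_injective⟩
  exact .of_isIntegrallyClosed_of_isIntegrallyClosedIn _ (AddMonoidAlgebra R L)

theorem exists_add_eq_of_single_dvd_single {G : Type*} [AddCommMonoid G] [Nontrivial R] {a b : G}
    (h : (single a 1 : AddMonoidAlgebra R G) ∣ single b 1) : ∃ c, a + c = b := by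
  obtain ⟨x, hx⟩ := h
  by_contra! hne
  simpa [coeff_single_mul_of_forall_add_ne, hne] using congrArg (fun y => y.coeff b) hx

theorem isSaturated_of_isIntegrallyClosed [IsDomain R] [Module.Free ℤ L]
    {S : AddSubmonoid L} [IsIntegrallyClosed (AddMonoidAlgebra R S)]
    (hS : ∀ m, ∃ a ∈ S, a + m ∈ S) : IsSaturated S := by
  intro k m hk hkm
  obtain ⟨a, ha, ham⟩ := hS m
  have hdvd : (single ⟨a, ha⟩ 1 : AddMonoidAlgebra R S) ^ k ∣ single ⟨a + m, ham⟩ 1 ^ k := by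
    refine ⟨single ⟨k • m, hkm⟩ 1, ?_⟩
    simp [single_pow, single_mul_single, smul_add]
  obtain ⟨c, hc⟩ := exists_add_eq_of_single_dvd_single
    ((IsIntegrallyClosed.pow_dvd_pow_iff hk.ne').1 hdvd)
  have hcm : (c : L) = m := add_left_cancel (congrArg Subtype.val hc)
  exact hcm ▸ c.2

end SemigroupAlgebra

/-! ### Translation invariant spaces of functions -/

section Translation

variable {G K ι : Type*} [Monoid G] [Field K] {χ : ι → G →* K}

theorem coe_mem_of_linearCombination_mem (hχ : Function.Injective χ) {A : Submodule K (G → K)}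
    (hA : ∀ f ∈ A, ∀ g, (fun h => f (g * h)) ∈ A) {l : ι →₀ K}
    (hl : Finsupp.linearCombination K (fun i => ⇑(χ i)) l ∈ A) {i : ι} (hi : i ∈ l.support) :
    ⇑(χ i) ∈ A := by
  by_contra hiA
  obtain ⟨ℓ, hℓ, hℓA⟩ := Submodule.exists_le_ker_of_notMem hiA
  -- Applying `ℓ` to the translates of the combination gives a linear relation among the `χ j`.
  have translate_eq (g : G) :
      (fun h => Finsupp.linearCombination K (fun j => ⇑(χ j)) l (g * h)) =
        ∑ j ∈ l.support, (l j * χ j g) • ⇑(χ j) := by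
    ext h
    simp [Finsupp.linearCombination_apply, Finsupp.sum, mul_assoc]
  have relation : ∑ j ∈ l.support, (l j * ℓ (χ j)) • ⇑(χ j) = 0 := by
    ext g
    have h : ℓ _ = 0 := hℓA (hA _ hl g)
    rw [translate_eq, map_sum] at h
    simpa [mul_right_comm] using h
  have coeff_eq_zero := linearIndependent_iff'.1 ((linearIndependent_monoidHom G K).comp χ hχ)
    l.support _ relation i hi
  exact mul_ne_zero (Finsupp.mem_support_iff.1 hi) hℓ coeff_eq_zero

theorem le_span_image_setOf_coe_mem (hχ : Function.Injective χ) {A : Submodule K (G → K)}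
    (hA : ∀ f ∈ A, ∀ g, (fun h => f (g * h)) ∈ A)
    (hspan : A ≤ Submodule.span K (Set.range fun i => ⇑(χ i))) :
    A ≤ Submodule.span K ((fun i => ⇑(χ i)) '' {i | ⇑(χ i) ∈ A}) := by
  intro f hf
  obtain ⟨l, rfl⟩ := Finsupp.mem_span_range_iff_exists_finsupp.1 (hspan hf)
  exact sum_mem fun i hi => Submodule.smul_mem _ _ <| Submodule.subset_span
    ⟨i, coe_mem_of_linearCombination_mem hχ hA hf hi, rfl⟩

end Translation

/-! ### Characters of the standard torus -/

section Torus

variable {n : ℕ}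

/-- The Laurent monomial with exponent `a`, as a character of `(ℂ^*)^n`. -/
def laurentMonomial (a : Fin n → ℤ) : (Fin n → ℂˣ) →* ℂˣ where
  toFun t := ∏ i, t i ^ a i
  map_one' := by simp
  map_mul' t t' := by simp [mul_zpow, Finset.prod_mul_distrib]

theorem laurentMonomial_apply (a : Fin n → ℤ) (t : Fin n → ℂˣ) :
    laurentMonomial a t = ∏ i, t i ^ a i := rfl

theorem laurentMonomial_add (a b : Fin n → ℤ) :
    laurentMonomial (a + b) = laurentMonomial a * laurentMonomial b := by
  ext t
  simp [laurentMonomial_apply, zpow_add, Finset.prod_mul_distrib]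

theorem laurentMonomial_injective : Function.Injective (laurentMonomial (n := n)) := by
  intro a b h
  ext i
  have norm_eq (a : Fin n → ℤ) :
      ‖(laurentMonomial a (Pi.mulSingle i (Units.mk0 2 two_ne_zero)) : ℂ)‖ = 2 ^ a i := by
    rw [laurentMonomial_apply, Finset.prod_eq_single i]
    · simp
    · intro j _ hj
      simp [Pi.mulSingle_eq_of_ne hj]
    · simp
  refine zpow_right_injective₀ (two_pos (α := ℝ)) (by norm_num) ?_
  change (2 : ℝ) ^ a i = 2 ^ b i
  rw [← norm_eq, ← norm_eq, h]

theorem eval_torusCoords (p : MvPolynomial (Fin n) ℂ) (t : Fin n → ℂˣ) :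
    eval (torusCoords n t) p =
      ∑ d ∈ p.support, p.coeff d * laurentMonomial (fun i => (d i : ℤ)) t := by
  simp [eval_eq', laurentMonomial_apply, torusCoords]

theorem isRegularFun_laurentMonomial (a : Fin n → ℤ) :
    IsRegularFun (torusCoords n) (fun t => (laurentMonomial a t : ℂ)) := by
  refine isRegularFun_iff_exists_mem_denominatorIdeal.2 fun t => ⟨∏ i, X i ^ (-a i).toNat,
    ⟨∏ i, X i ^ (a i).toNat, fun t => ?_⟩, by simp [torusCoords, Finset.prod_ne_zero_iff]⟩
  simp only [laurentMonomial_apply, Units.coe_prod, Units.val_zpow_eq_zpow_val, map_prod, map_pow,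
    eval_X, torusCoords, ← Finset.prod_mul_distrib]
  refine Finset.prod_congr rfl fun i _ => ?_
  rw [← zpow_natCast, ← zpow_natCast, ← zpow_add₀ (t i).ne_zero]
  congr 1
  omega

theorem IsRegularFun.mem_span_laurentMonomial {f : (Fin n → ℂˣ) → ℂ}
    (hf : IsRegularFun (torusCoords n) f) :
    f ∈ Submodule.span ℂ (Set.range fun a t => (laurentMonomial a t : ℂ)) := by
  obtain ⟨k, p, hp⟩ := hf.exists_pow_mul_eq_eval (∏ i, X i) fun y _ hy => by
    have hy' (i) : y i ≠ 0 := by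
      simp only [map_prod, eval_X, Finset.prod_ne_zero_iff] at hy
      exact hy i (Finset.mem_univ i)
    exact ⟨fun i => Units.mk0 (y i) (hy' i), rfl⟩
  have prod_pow_eq (t : Fin n → ℂˣ) : eval (torusCoords n t) (∏ i, X i) ^ k =
      laurentMonomial (fun _ => (k : ℤ)) t := by
    simp [laurentMonomial_apply, torusCoords, Finset.prod_pow]
  have eq_sum : f = ∑ d ∈ p.support, p.coeff d •
      fun t => (laurentMonomial ((fun i => (d i : ℤ)) + fun _ => (-k : ℤ)) t : ℂ) := by
    ext t
    have mul_neg_eq_one : (laurentMonomial (fun _ => (k : ℤ)) t : ℂ) *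
        laurentMonomial (fun _ => -k) t = 1 := by
      simp [laurentMonomial_apply, Finset.prod_ne_zero_iff]
    have mul_eq := hp t
    rw [prod_pow_eq, eval_torusCoords] at mul_eq
    rw [← mul_one (f t), ← mul_neg_eq_one, ← mul_assoc, mul_comm (f t), mul_eq, Finset.sum_mul]
    simp [laurentMonomial_add, mul_assoc]
  rw [eq_sum]
  exact sum_mem fun d _ => Submodule.smul_mem _ _ (Submodule.subset_span ⟨_, rfl⟩)

end Torus

namespace AffineToricVariety

variable {s : ℕ} (X : AffineToricVariety s)

/-! ### The character lattice -/

/-- The character `χ^m` as a complex valued function on the torus. -/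
def charFun (m : X.M) : X.T →* ℂ := (Units.coeHom ℂ).comp (X.char m)

theorem charFun_injective : Function.Injective X.charFun := fun _ _ h =>
  Additive.toMul.injective <| Subtype.ext <| MonoidHom.ext fun t =>
    Units.ext (DFunLike.congr_fun h t)

theorem charFun_zero : X.charFun 0 = 1 := rfl

theorem charFun_add (m m' : X.M) : X.charFun (m + m') = X.charFun m * X.charFun m' := rfl

theorem isRegularFun_charFun (m : X.M) : IsRegularFun (coords X.T) (X.charFun m) :=
  (Additive.toMul m).2

theorem linearIndependent_charFun : LinearIndependent ℂ fun m => ⇑(X.charFun m) :=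
  (linearIndependent_monoidHom X.T ℂ).comp X.charFun X.charFun_injective

theorem exists_laurentHom : ∃ (n : ℕ) (Ψ : (Fin n → ℤ) →+ X.M), Function.Injective Ψ ∧
    ∀ f : X.T → ℂ, IsRegularFun (coords X.T) f →
      f ∈ Submodule.span ℂ (Set.range fun a => ⇑(X.charFun (Ψ a))) := by
  obtain ⟨n, φ, hφ, hφ'⟩ := X.torus
  let Ψ : (Fin n → ℤ) →+ X.M := AddMonoidHom.mk' (fun a => Additive.ofMul
    ⟨(laurentMonomial a).comp φ.symm.toMonoidHom, (isRegularFun_laurentMonomial a).comp hφ'⟩)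
    fun a b => Additive.toMul.injective <| Subtype.ext <|
      congrArg (fun χ => χ.comp φ.symm.toMonoidHom) (laurentMonomial_add a b)
  have charFun_Ψ (a t) : X.charFun (Ψ a) t = laurentMonomial a (φ.symm t) := rfl
  refine ⟨n, Ψ, fun a b hab => laurentMonomial_injective (MonoidHom.ext fun t => Units.ext ?_),
    fun f hf => ?_⟩
  · simpa [charFun_Ψ] using DFunLike.congr_fun (congrArg X.charFun hab) (φ t)
  · have h := Submodule.mem_map_of_mem (f := LinearMap.funLeft ℂ ℂ φ.symm)
      (hf.comp hφ).mem_span_laurentMonomial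
    rw [Submodule.map_span, ← Set.range_comp] at h
    convert h using 1
    · rfl
    · ext t
      simp [LinearMap.funLeft_apply]

theorem exists_latticeEquiv : ∃ n : ℕ, Nonempty ((Fin n → ℤ) ≃+ X.M) := by
  obtain ⟨n, Ψ, hΨ, hspan⟩ := X.exists_laurentHom
  refine ⟨n, ⟨AddEquiv.ofBijective Ψ ⟨hΨ, fun m => ?_⟩⟩⟩
  by_contra hm
  refine X.linearIndependent_charFun.notMem_span_image (s := Set.range Ψ) hm ?_
  rw [← Set.range_comp]
  exact hspan _ (X.isRegularFun_charFun m)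

instance : Module.Free ℤ X.M :=
  let ⟨_, ⟨Ψ⟩⟩ := X.exists_latticeEquiv
  .of_equiv Ψ.toIntLinearEquiv

instance : Module.Finite ℤ X.M :=
  let ⟨_, ⟨Ψ⟩⟩ := X.exists_latticeEquiv
  .equiv Ψ.toIntLinearEquiv

theorem mem_span_range_charFun {f : X.T → ℂ} (hf : IsRegularFun (coords X.T) f) :
    f ∈ Submodule.span ℂ (Set.range fun m => ⇑(X.charFun m)) := by
  obtain ⟨n, Ψ, -, hspan⟩ := X.exists_laurentHom
  exact Submodule.span_mono (Set.range_comp_subset_range Ψ fun m => ⇑(X.charFun m)) (hspan f hf)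

/-! ### The coordinate ring as a semigroup algebra -/

/-- The inclusion of the semigroup algebra `ℂ[S]` in the algebra of functions on the torus. -/
def charHom (S : AddSubmonoid X.M) : AddMonoidAlgebra ℂ S →ₐ[ℂ] (X.T → ℂ) :=
  AddMonoidAlgebra.lift ℂ _ S
    { toFun m := X.charFun (m.toAdd : X.M)
      map_one' := congrArg _ X.charFun_zero
      map_mul' _ _ := congrArg _ (X.charFun_add _ _) }

theorem charHom_single (S : AddSubmonoid X.M) (m : S) (a : ℂ) :
    X.charHom S (AddMonoidAlgebra.single m a) = a • ⇑(X.charFun m) := by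
  simp [charHom]

theorem charHom_apply (S : AddSubmonoid X.M) (x : AddMonoidAlgebra ℂ S) :
    X.charHom S x = Finsupp.linearCombination ℂ (fun m : S => ⇑(X.charFun m)) x.coeff := by
  simp [charHom, AddMonoidAlgebra.lift_apply, Finsupp.linearCombination_apply]

theorem charHom_injective (S : AddSubmonoid X.M) : Function.Injective (X.charHom S) := by
  intro x y hxy
  simp only [charHom_apply] at hxy
  exact AddMonoidAlgebra.coeff_injective
    (X.linearIndependent_charFun.comp ((↑) : S → X.M) Subtype.val_injective hxy)

theorem toSubmodule_range_charHom (S : AddSubmonoid X.M) :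
    Subalgebra.toSubmodule (X.charHom S).range =
      Submodule.span ℂ ((fun m => ⇑(X.charFun m)) '' S) := by
  ext f
  rw [Subalgebra.mem_toSubmodule, AlgHom.mem_range, Set.image_eq_range,
    Finsupp.mem_span_range_iff_exists_finsupp]
  constructor
  · rintro ⟨x, rfl⟩
    exact ⟨x.coeff, (X.charHom_apply S x).symm⟩
  · rintro ⟨l, rfl⟩
    exact ⟨.ofCoeff l, X.charHom_apply S _⟩

/-- Restriction of regular functions from `V` to the torus. -/
def restrictTorus : CoordRing X.V →ₐ[ℂ] (X.T → ℂ) :=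
  AlgHom.pi fun t => evalAt ⟨t.1, X.subset t.2⟩

theorem restrictTorus_apply (r : CoordRing X.V) (t : X.T) :
    X.restrictTorus r t = evalAt ⟨t.1, X.subset t.2⟩ r := rfl

theorem restrictTorus_mk (p : MvPolynomial (Fin s) ℂ) :
    X.restrictTorus (Ideal.Quotient.mk _ p) = fun t => eval t.1 p := by
  ext t
  rw [restrictTorus_apply, evalAt_mk]

theorem restrictTorus_injective : Function.Injective X.restrictTorus := by
  refine (injective_iff_map_eq_zero _).2 fun r hr => ?_
  obtain ⟨p, rfl⟩ := Ideal.Quotient.mk_surjective r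
  rw [restrictTorus_mk] at hr
  have subset_zeros := X.dense {x | ∀ f ∈ ({p} : Finset (MvPolynomial (Fin s) ℂ)), eval x f = 0}
    ⟨{p}, rfl⟩ fun t ht => by simpa using congrFun hr ⟨t, ht⟩
  exact Ideal.Quotient.eq_zero_iff_mem.2 fun x hx => by
    simpa [aeval_eq_eval] using subset_zeros hx

theorem mem_range_restrictTorus {f : X.T → ℂ} :
    f ∈ X.restrictTorus.range ↔ ∃ p, ∀ t, f t = eval (coords X.T t) p := by
  rw [AlgHom.mem_range, Ideal.Quotient.mk_surjective.exists]
  simp only [restrictTorus_mk, funext_iff, eq_comm, coords]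

theorem isRegularFun_of_mem_range_restrictTorus {f : X.T → ℂ} (hf : f ∈ X.restrictTorus.range) :
    IsRegularFun (coords X.T) f := by
  obtain ⟨p, hp⟩ := X.mem_range_restrictTorus.1 hf
  rw [funext hp]
  exact isRegularFun_eval (coords X.T) p

theorem translate_mem_range_restrictTorus {f : X.T → ℂ} (hf : f ∈ X.restrictTorus.range)
    (t : X.T) : (fun t' => f (t * t')) ∈ X.restrictTorus.range := by
  obtain ⟨p, hp⟩ := X.mem_range_restrictTorus.1 hf
  obtain ⟨act, hact, -, -, act_eq_mul⟩ := X.action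
  have isRegularMap_mk : IsRegularMap (coords X.V) (prodCoords (coords X.T) (coords X.V))
      (fun x => (t, x)) := by
    rintro (j | j)
    · simpa [prodCoords, coords] using isRegularFun_eval (coords X.V) (C (t.1 j))
    · simpa [prodCoords] using isRegularFun_eval (coords X.V) (MvPolynomial.X j)
  obtain ⟨q, hq⟩ := (isRegularFun_eval_of_forall
    (fun j => (hact j).comp isRegularMap_mk) p).exists_eq_eval X.isAffineVariety
  refine X.mem_range_restrictTorus.2 ⟨q, fun t' => ?_⟩
  refine .trans ?_ (hq ⟨t'.1, X.subset t'.2⟩)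
  rw [hp, act_eq_mul]
  rfl

/-- The semigroup of the characters that extend to regular functions on `V`. -/
def extendingSemigroup : AddSubmonoid X.M where
  carrier := {m | ⇑(X.charFun m) ∈ X.restrictTorus.range}
  zero_mem' := one_mem X.restrictTorus.range
  add_mem' hm hm' := mul_mem (s := X.restrictTorus.range) hm hm'

theorem range_charHom_extendingSemigroup :
    (X.charHom X.extendingSemigroup).range = X.restrictTorus.range := by
  apply Subalgebra.toSubmodule_injective
  rw [toSubmodule_range_charHom]
  refine le_antisymm (Submodule.span_le.2 ?_) ?_
  · rintro _ ⟨m, hm, rfl⟩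
    exact hm
  · refine le_span_image_setOf_coe_mem X.charFun_injective
      (fun f hf => X.translate_mem_range_restrictTorus hf) ?_
    exact fun f hf => X.mem_span_range_charFun (X.isRegularFun_of_mem_range_restrictTorus hf)

/-- The identification of `ℂ[V]` with the semigroup algebra of the characters that extend to `V`;
both are the same algebra of functions on the torus. -/
def semigroupAlgebraEquiv : AddMonoidAlgebra ℂ X.extendingSemigroup ≃ₐ[ℂ] CoordRing X.V :=
  (AlgEquiv.ofInjective _ (X.charHom_injective _)).trans
    ((Subalgebra.equivOfEq _ _ X.range_charHom_extendingSemigroup).trans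
      (AlgEquiv.ofInjective _ X.restrictTorus_injective).symm)

theorem restrictTorus_semigroupAlgebraEquiv (x : AddMonoidAlgebra ℂ X.extendingSemigroup) :
    X.restrictTorus (X.semigroupAlgebraEquiv x) = X.charHom _ x :=
  congrArg Subtype.val ((AlgEquiv.ofInjective _ X.restrictTorus_injective).apply_symm_apply
    (Subalgebra.equivOfEq _ _ X.range_charHom_extendingSemigroup
      (AlgEquiv.ofInjective _ (X.charHom_injective _) x)))

theorem eqSpecm_extendingSemigroup : X.EqSpecm X.extendingSemigroup := by
  refine ⟨SpecmIso.ofAlgEquiv X.isAffineVariety X.semigroupAlgebraEquiv, fun m t => ?_⟩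
  have := X.restrictTorus_semigroupAlgebraEquiv (AddMonoidAlgebra.single m 1)
  rw [charHom_single, one_smul] at this
  exact congrFun this t

theorem fg_extendingSemigroup : X.extendingSemigroup.FG := by
  have : Algebra.FiniteType ℂ (AddMonoidAlgebra ℂ X.extendingSemigroup) :=
    .equiv inferInstance X.semigroupAlgebraEquiv.symm
  exact (AddMonoid.fg_iff_addSubmonoid_fg _).1 (AddMonoidAlgebra.finiteType_iff_fg.1 this)

theorem exists_mul_charFun_mem_range (m : X.M) : ∃ q ∈ X.restrictTorus.range, q ≠ 0 ∧
    q * X.charFun m ∈ X.restrictTorus.range := by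
  obtain ⟨q, ⟨p, hp⟩, hq⟩ :=
    isRegularFun_iff_exists_mem_denominatorIdeal.1 (X.isRegularFun_charFun m) 1
  exact ⟨fun t => eval (coords X.T t) q, X.mem_range_restrictTorus.2 ⟨q, fun _ => rfl⟩,
    fun h => hq (congrFun h 1), X.mem_range_restrictTorus.2 ⟨p, hp⟩⟩

theorem exists_add_mem_extendingSemigroup (m : X.M) :
    ∃ a ∈ X.extendingSemigroup, a + m ∈ X.extendingSemigroup := by
  let A := Subalgebra.toSubmodule X.restrictTorus.range
  -- The denominators of `χ^m`: a translation invariant space, hence spanned by characters.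
  let B := A ⊓ A.comap (LinearMap.mulRight ℂ ⇑(X.charFun m))
  have translate_mem (f) (hf : f ∈ B) (t : X.T) : (fun t' => f (t * t')) ∈ B := by
    refine ⟨X.translate_mem_range_restrictTorus hf.1 t, ?_⟩
    have translate_mul : (fun t' => f (t * t')) * ⇑(X.charFun m) =
        (X.charFun m t)⁻¹ • fun t' => (f * ⇑(X.charFun m)) (t * t') := by
      have : X.charFun m t ≠ 0 := (X.char m t).ne_zero
      ext t'
      simp [field]
    rw [SetLike.mem_coe, Submodule.mem_comap, LinearMap.mulRight_apply, translate_mul]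
    exact A.smul_mem _ (X.translate_mem_range_restrictTorus hf.2 t)
  have le_span : B ≤ Submodule.span ℂ (Set.range fun m => ⇑(X.charFun m)) :=
    fun f hf => X.mem_span_range_charFun (X.isRegularFun_of_mem_range_restrictTorus hf.1)
  obtain ⟨q, hq, hq0, hqm⟩ := X.exists_mul_charFun_mem_range m
  have hqB := le_span_image_setOf_coe_mem X.charFun_injective translate_mem le_span ⟨hq, hqm⟩
  by_contra! h
  have no_char : {a | ⇑(X.charFun a) ∈ B} = ∅ := Set.eq_empty_of_forall_notMem fun a ha =>
    h a ha.1 ha.2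
  rw [no_char] at hqB
  simp [hq0] at hqB

theorem isSaturatedAffineSemigroup_extendingSemigroup (h : IsNormalVariety X.V) :
    X.IsSaturatedAffineSemigroup X.extendingSemigroup :=
  have : IsIntegrallyClosed (CoordRing X.V) := h
  have : IsIntegrallyClosed (AddMonoidAlgebra ℂ X.extendingSemigroup) :=
    .of_equiv X.semigroupAlgebraEquiv.symm.toRingEquiv
  ⟨X.fg_extendingSemigroup, isSaturated_of_isIntegrallyClosed (R := ℂ)
    X.exists_add_mem_extendingSemigroup⟩

theorem EqSpecm.isoSpecm {X : AffineToricVariety s} {S : AddSubmonoid X.M} (h : X.EqSpecm S) :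
    X.IsoSpecm S :=
  let ⟨e, _⟩ := h
  ⟨e⟩

theorem isNormalVariety_of_isoSpecm {S : AddSubmonoid X.M} (hS : X.IsSaturatedAffineSemigroup S)
    (h : X.IsoSpecm S) : IsNormalVariety X.V := by
  obtain ⟨e⟩ := h
  have := isIntegrallyClosed_of_isSaturated (R := ℂ) hS.2 hS.1
  exact IsIntegrallyClosed.of_equiv e.toAlgEquiv.toRingEquiv

/-! ### Rational cones -/

theorem coneSemigroup_hull (A : Set X.N) :
    X.coneSemigroup (PointedCone.hull ℝ ((fun u : X.N => (1 : ℝ) ⊗ₜ[ℤ] u) '' A)) =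
      (PointedCone.dual (Module.Dual.eval ℤ X.M).flip A).toAddSubmonoid := by
  ext m
  change X.toMReal m ∈ PointedCone.dual _ _ ↔ _
  rw [PointedCone.dual_hull]
  simp [toMReal_tmul]

theorem toMReal_basis_sum {ι : Type*} [Fintype ι] (b : Module.Basis ι ℤ X.M) (x : X.NReal) :
    ∑ i, X.toMReal (b i) x • ((1 : ℝ) ⊗ₜ[ℤ] b.coord i) = x := by
  induction x using TensorProduct.induction_on with
  | zero => simp
  | add x y hx hy =>
    conv_rhs => rw [← hx, ← hy]
    simp [add_smul, Finset.sum_add_distrib]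
  | tmul a u =>
    have hu : u = ∑ i, u (b i) • b.coord i := b.ext fun j => by simp
    conv_rhs => rw [hu, TensorProduct.tmul_sum]
    refine Finset.sum_congr rfl fun i _ => ?_
    rw [toMReal_tmul, TensorProduct.smul_tmul', ← TensorProduct.smul_tmul]
    simp [mul_comm]

theorem eq_zero_of_forall_toMReal {x : X.NReal} (hx : ∀ m, X.toMReal m x = 0) : x = 0 := by
  simpa [hx] using (X.toMReal_basis_sum (Module.Free.chooseBasis ℤ X.M) x).symm

theorem isStronglyConvex_of_forall_exists_add_mem {σ : PointedCone ℝ X.NReal}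
    (h : ∀ m, ∃ a ∈ X.coneSemigroup σ, a + m ∈ X.coneSemigroup σ) : X.IsStronglyConvex σ := by
  refine Set.eq_singleton_iff_unique_mem.2 ⟨by simp, fun x ⟨hx, hx'⟩ => ?_⟩
  have toMReal_eq_zero (m) (hm : m ∈ X.coneSemigroup σ) : X.toMReal m x = 0 :=
    le_antisymm (by simpa using hm hx') (hm hx)
  refine X.eq_zero_of_forall_toMReal fun m => ?_
  obtain ⟨a, ha, ham⟩ := h m
  simpa [toMReal_eq_zero a ha] using toMReal_eq_zero _ ham

theorem isSaturatedAffineSemigroup_coneSemigroup {σ : PointedCone ℝ X.NReal}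
    (hσ : X.IsRationalCone σ) : X.IsSaturatedAffineSemigroup (X.coneSemigroup σ) := by
  obtain ⟨A, rfl⟩ := hσ
  rw [coneSemigroup_hull]
  exact ⟨fg_toAddSubmonoid_dual _ A.finite_toSet, isSaturated_toAddSubmonoid_dual _ _⟩

theorem exists_coneSemigroup_eq {S : AddSubmonoid X.M} (hS : X.IsSaturatedAffineSemigroup S) :
    ∃ σ : PointedCone ℝ X.NReal, X.IsRationalCone σ ∧ X.coneSemigroup σ = S := by
  have fg_dual : (PointedCone.dual (Module.Dual.eval ℤ X.M) S).toAddSubmonoid.FG := by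
    obtain ⟨t, ht⟩ := hS.1
    rw [← ht, dual_addSubmonoidClosure]
    exact fg_toAddSubmonoid_dual _ t.finite_toSet
  obtain ⟨A, hA⟩ := fg_dual
  refine ⟨_, ⟨A, rfl⟩, ?_⟩
  rw [coneSemigroup_hull, ← dual_addSubmonoidClosure, hA]
  exact IsSaturated.dual_flip_dual_eq hS.2 hS.1

end AffineToricVariety

end AffineToric

end

theorem mainTheorem5 {s : ℕ} (X : AffineToric.AffineToricVariety s) :
    List.TFAE [
      AffineToric.IsNormalVariety X.V,
      ∃ S : AddSubmonoid X.M, X.IsSaturatedAffineSemigroup S ∧ X.EqSpecm S,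
      ∃ S : AddSubmonoid X.M, X.IsSaturatedAffineSemigroup S ∧ X.IsoSpecm S,
      ∃ σ : PointedCone ℝ X.NReal, X.IsRationalCone σ ∧ X.IsStronglyConvex σ ∧
        X.EqSpecm (X.coneSemigroup σ),
      ∃ σ : PointedCone ℝ X.NReal, X.IsRationalCone σ ∧ X.IsStronglyConvex σ ∧
        X.IsoSpecm (X.coneSemigroup σ)] := by
  tfae_have 1 → 4 := fun h => by
    obtain ⟨σ, hσ, hS⟩ := X.exists_coneSemigroup_eq
      (X.isSaturatedAffineSemigroup_extendingSemigroup h)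
    exact ⟨σ, hσ, X.isStronglyConvex_of_forall_exists_add_mem
      (hS ▸ X.exists_add_mem_extendingSemigroup), hS ▸ X.eqSpecm_extendingSemigroup⟩
  tfae_have 4 → 2 := fun ⟨σ, hσ, _, h⟩ =>
    ⟨X.coneSemigroup σ, X.isSaturatedAffineSemigroup_coneSemigroup hσ, h⟩
  tfae_have 2 → 3 := fun ⟨S, hS, h⟩ => ⟨S, hS, h.isoSpecm⟩
  tfae_have 3 → 1 := fun ⟨_, hS, h⟩ => X.isNormalVariety_of_isoSpecm hS h
  tfae_have 4 → 5 := fun ⟨σ, hσ, hσ', h⟩ => ⟨σ, hσ, hσ', h.isoSpecm⟩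
  tfae_have 5 → 3 := fun ⟨σ, hσ, _, h⟩ =>
    ⟨X.coneSemigroup σ, X.isSaturatedAffineSemigroup_coneSemigroup hσ, h⟩
  tfae_finish
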